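/- Let $R$ be a complex Banach algebra, not necessarily unital, with $\|rs\|\le\|r\|\,\|s\|$. For $n\ge 1$ put $S(n)=\sup\|r_1r_2\cdots r_n\|^{1/n}$, the supremum being over all $r_1,\dots,r_n$ in the closed unit ball of $R$; $R$ is called topologically nilpotent if $\lim_{n\to\infty}S(n)=0$. A left Banach $R$-module is a complex Banach space $X$ with a bilinear associative left action of $R$ such that $\|r\cdot x\|\le\|r\|\,\|x\|$; morphisms are bounded linear maps commuting with the action. A morphism $\psi\colon X_0\to X$ is small if every morphism $\phi\colon Y\to X$ of left Banach $R$-modules for which $Y\oplus X_0\to X$, $(y,z)\mapsto\phi(y)+\psi(z)$, is surjective is itself surjective. A left Banach $R$-module $P$ is strictly projective if for every surjective morphism $\varepsilon\colon Y\to P$ of left Banach $R$-modules there is a morphism $\rho\colon P\to Y$ with $\varepsilon\rho=1$. Finally, $R\,\widehat\otimes_R X$ is the quotient of the completed projective tensor product $R\,\widehat\otimes X$ by the closed linear span of the elements $ra\otimes x-r\otimes a\cdot x$ ($r,a\in R$, $x\in X$), with the left action $r\cdot(s\otimes x)=rs\otimes x$. Then the following conditions are equivalent: (1) $R$ is topologically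 nilpotent; (2) for every left Banach $R$-module $X$ the morphism $R\,\widehat\otimes_R X\to X$, $r\otimes_R x\mapsto r\cdot x$, is small; (3) for every strictly projective left Banach $R$-module $P$ the morphism $R\,\widehat\otimes_R P\to P$, $r\otimes_R x\mapsto r\cdot x$, is small. -/

import Mathlib

universe u

set_option linter.unusedSectionVars false

open scoped TensorProduct

noncomputable section

/-! ### The projective tensor product of complex normed spaces -/

/-- The algebraic tensor product `E ⊗ F` over `ℂ`; a type synonym that carries the projective
seminorm. -/
def ProjTensor (E F : Type*) [NormedAddCommGroup E] [NormedSpace ℂ E]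
    [NormedAddCommGroup F] [NormedSpace ℂ F] : Type _ := E ⊗[ℂ] F

namespace ProjTensor

variable (E F : Type*) [NormedAddCommGroup E] [NormedSpace ℂ E]
  [NormedAddCommGroup F] [NormedSpace ℂ F]

instance : AddCommGroup (ProjTensor E F) := inferInstanceAs (AddCommGroup (E ⊗[ℂ] F))

instance : Module ℂ (ProjTensor E F) := inferInstanceAs (Module ℂ (E ⊗[ℂ] F))

variable {E F}

/-- The finite sum `∑ eᵢ ⊗ fᵢ` encoded by a list of pairs. -/
def ofList (l : List (E × F)) : ProjTensor E F :=
  (l.map fun p => (p.1 ⊗ₜ[ℂ] p.2 : E ⊗[ℂ] F)).sum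

/-- The number `∑ ‖eᵢ‖ ‖fᵢ‖` of a list of pairs. -/
def cost (l : List (E × F)) : ℝ := (l.map fun p => ‖p.1‖ * ‖p.2‖).sum

theorem cost_nonneg (l : List (E × F)) : 0 ≤ cost l := by
  refine List.sum_nonneg fun a ha => ?_
  obtain ⟨p, -, rfl⟩ := List.mem_map.1 ha
  positivity

theorem ofList_append (l m : List (E × F)) : ofList (l ++ m) = ofList l + ofList m := by
  unfold ofList
  rw [List.map_append, List.sum_append]
  rfl

theorem cost_append (l m : List (E × F)) : cost (l ++ m) = cost l + cost m := by
  simp [cost]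

theorem ofList_smul (c : ℂ) (l : List (E × F)) :
    ofList (l.map fun p => (c • p.1, p.2)) = c • ofList l := by
  induction l with
  | nil =>
    have h0 : (0 : ProjTensor E F) = c • (0 : ProjTensor E F) := (smul_zero c).symm
    exact h0
  | cons p l ih =>
    have h1 : ofList (p :: l) = (ofList [p] + ofList l) := ofList_append [p] l
    have h2 : ofList ((c • p.1, p.2) :: l.map fun p => (c • p.1, p.2))
        = ofList [(c • p.1, p.2)] + ofList (l.map fun p => (c • p.1, p.2)) :=
      ofList_append [(c • p.1, p.2)] _
    have h3 : ofList [(c • p.1, p.2)] = c • ofList [p] := by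
      have : ((c • p.1) ⊗ₜ[ℂ] p.2 + 0 : E ⊗[ℂ] F) = c • (p.1 ⊗ₜ[ℂ] p.2 + 0) := by
        simp [TensorProduct.smul_tmul']
      exact this
    rw [List.map_cons, h2, h1, smul_add, ih, h3]

theorem cost_smul (c : ℂ) (l : List (E × F)) :
    cost (l.map fun p => (c • p.1, p.2)) = ‖c‖ * cost l := by
  simp [cost, Function.comp_def, norm_smul, mul_assoc, List.sum_map_mul_left]

theorem exists_ofList (t : ProjTensor E F) : ∃ l, ofList l = t := by
  refine TensorProduct.induction_on (motive := fun t : E ⊗[ℂ] F => ∃ l, ofList l = t) t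
    ⟨[], rfl⟩ (fun e f => ⟨[(e, f)], add_zero _⟩) ?_
  rintro x y ⟨l, rfl⟩ ⟨m, rfl⟩
  exact ⟨l ++ m, ofList_append l m⟩

/-- The projective seminorm: the infimum of `∑ ‖eᵢ‖ ‖fᵢ‖` over all finite representations
`t = ∑ eᵢ ⊗ fᵢ`. -/
def projNorm (t : ProjTensor E F) : ℝ := sInf (cost '' {l : List (E × F) | ofList l = t})

theorem projNorm_le {t : ProjTensor E F} {l : List (E × F)} (h : ofList l = t) :
    projNorm t ≤ cost l :=
  csInf_le ⟨0, by rintro _ ⟨l, -, rfl⟩; exact cost_nonneg l⟩ ⟨l, h, rfl⟩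

theorem le_projNorm {t : ProjTensor E F} {a : ℝ} (h : ∀ l, ofList l = t → a ≤ cost l) :
    a ≤ projNorm t := by
  obtain ⟨l, hl⟩ := exists_ofList t
  refine le_csInf ⟨_, l, hl, rfl⟩ ?_
  rintro _ ⟨m, hm, rfl⟩
  exact h m hm

theorem projNorm_zero : projNorm (0 : ProjTensor E F) = 0 :=
  le_antisymm (projNorm_le (l := []) rfl) (le_projNorm fun l _ => cost_nonneg l)

theorem projNorm_add_le (s t : ProjTensor E F) : projNorm (s + t) ≤ projNorm s + projNorm t := by
  rw [← sub_le_iff_le_add]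
  refine le_projNorm fun l hl => ?_
  rw [sub_le_comm]
  refine le_projNorm fun m hm => ?_
  rw [sub_le_iff_le_add, add_comm, ← cost_append]
  exact projNorm_le (by rw [ofList_append, hl, hm])

theorem projNorm_smul_le (c : ℂ) (t : ProjTensor E F) : projNorm (c • t) ≤ ‖c‖ * projNorm t := by
  rcases (norm_nonneg c).eq_or_lt with hc | hc
  · rw [← hc, norm_eq_zero.1 hc.symm, zero_smul, projNorm_zero, zero_mul]
  rw [← div_le_iff₀' hc]
  refine le_projNorm fun l hl => ?_
  rw [div_le_iff₀' hc, ← cost_smul]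
  exact projNorm_le (by rw [ofList_smul, hl])

/-- The projective seminorm as a bundled seminorm. -/
def projSeminorm (E F : Type*) [NormedAddCommGroup E] [NormedSpace ℂ E]
    [NormedAddCommGroup F] [NormedSpace ℂ F] : Seminorm ℂ (ProjTensor E F) :=
  Seminorm.ofSMulLE projNorm projNorm_zero projNorm_add_le projNorm_smul_le

instance : SeminormedAddCommGroup (ProjTensor E F) :=
  (projSeminorm E F).toAddGroupSeminorm.toSeminormedAddCommGroup

instance : NormedSpace ℂ (ProjTensor E F) := ⟨projNorm_smul_le⟩

variable {G : Type*} [NormedAddCommGroup G] [NormedSpace ℂ G]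

/-- The linear map on the algebraic tensor product given by a bilinear map of bound `C`. -/
def liftAlg (f : E →ₗ[ℂ] F →ₗ[ℂ] G) (C : ℝ) (hf : ∀ e x, ‖f e x‖ ≤ C * (‖e‖ * ‖x‖)) :
    ProjTensor E F →L[ℂ] G :=
  LinearMap.mkContinuous (TensorProduct.lift f : E ⊗[ℂ] F →ₗ[ℂ] G) C (by
    have key : ∀ l : List (E × F),
        ‖(TensorProduct.lift f : E ⊗[ℂ] F →ₗ[ℂ] G) (ofList l)‖ ≤ C * cost l := by
      intro l
      induction l with
      | nil =>
        have : (TensorProduct.lift f : E ⊗[ℂ] F →ₗ[ℂ] G) (ofList []) = 0 := map_zero _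
        rw [this]; simp [cost]
      | cons p l ih =>
        have : (TensorProduct.lift f : E ⊗[ℂ] F →ₗ[ℂ] G) (ofList (p :: l))
            = f p.1 p.2 + TensorProduct.lift f (ofList l) := map_add _ _ _
        have hc : cost (p :: l) = ‖p.1‖ * ‖p.2‖ + cost l := by simp [cost]
        rw [this, hc, mul_add]
        exact (norm_add_le _ _).trans (add_le_add (hf _ _) ih)
    intro t
    change ‖_‖ ≤ C * projNorm t
    rcases le_or_gt C 0 with hC | hC
    · obtain ⟨l, rfl⟩ := exists_ofList t
      exact (key l).trans (mul_le_mul_of_nonpos_left (projNorm_le rfl) hC)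
    · rw [← div_le_iff₀' hC]
      refine le_projNorm fun l hl => ?_
      rw [div_le_iff₀' hC, ← hl]
      exact key l)

end ProjTensor

/-- The completed projective tensor product `E ⊗̂ F` of complex normed spaces. -/
abbrev ComplProjTensor (E F : Type*) [NormedAddCommGroup E] [NormedSpace ℂ E]
    [NormedAddCommGroup F] [NormedSpace ℂ F] : Type _ :=
  UniformSpace.Completion (ProjTensor E F)

namespace ComplProjTensor

variable {E F G : Type*} [NormedAddCommGroup E] [NormedSpace ℂ E]
  [NormedAddCommGroup F] [NormedSpace ℂ F] [NormedAddCommGroup G] [NormedSpace ℂ G]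

/-- The elementary tensor `e ⊗ f`, bilinear in `e` and `f`. -/
def tmul : E →ₗ[ℂ] F →ₗ[ℂ] ComplProjTensor E F :=
  (TensorProduct.mk ℂ E F).compr₂
    (UniformSpace.Completion.toComplL (𝕜 := ℂ) (E := ProjTensor E F)).toLinearMap

theorem norm_tmul_le (e : E) (f : F) : ‖tmul e f‖ ≤ ‖e‖ * ‖f‖ := by
  have h : ‖tmul e f‖ = ProjTensor.projNorm (E := E) (F := F) (e ⊗ₜ[ℂ] f : E ⊗[ℂ] F) :=
    UniformSpace.Completion.norm_coe (E := ProjTensor E F) (e ⊗ₜ[ℂ] f : E ⊗[ℂ] F)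
  rw [h]
  refine (ProjTensor.projNorm_le (l := [(e, f)]) (add_zero _)).trans (le_of_eq ?_)
  simp [ProjTensor.cost]

/-- Two bounded linear maps on `E ⊗̂ F` that agree on elementary tensors are equal. -/
theorem hom_ext {S T : ComplProjTensor E F →L[ℂ] G} (h : ∀ e f, S (tmul e f) = T (tmul e f)) :
    S = T := by
  have h1 : (S.toLinearMap ∘ₗ (UniformSpace.Completion.toComplL (𝕜 := ℂ)
        (E := ProjTensor E F)).toLinearMap : E ⊗[ℂ] F →ₗ[ℂ] G) =
      (T.toLinearMap ∘ₗ (UniformSpace.Completion.toComplL (𝕜 := ℂ)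
        (E := ProjTensor E F)).toLinearMap : E ⊗[ℂ] F →ₗ[ℂ] G) :=
    TensorProduct.ext' h
  ext x
  induction x using UniformSpace.Completion.induction_on with
  | hp => exact isClosed_eq S.continuous T.continuous
  | ih t => exact LinearMap.congr_fun h1 t

variable [CompleteSpace G]

/-- The bounded linear map `E ⊗̂ F → G` induced by a bounded bilinear map `E × F → G`. -/
def lift (f : E →ₗ[ℂ] F →ₗ[ℂ] G) (C : ℝ) (hf : ∀ e x, ‖f e x‖ ≤ C * (‖e‖ * ‖x‖)) :
    ComplProjTensor E F →L[ℂ] G :=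
  (ProjTensor.liftAlg f C hf).extend
    (UniformSpace.Completion.toComplL (𝕜 := ℂ) (E := ProjTensor E F))

theorem lift_coe (f : E →ₗ[ℂ] F →ₗ[ℂ] G) (C : ℝ) (hf : ∀ e x, ‖f e x‖ ≤ C * (‖e‖ * ‖x‖))
    (t : ProjTensor E F) :
    lift f C hf (t : ComplProjTensor E F) = ProjTensor.liftAlg f C hf t :=
  ContinuousLinearMap.extend_eq _ UniformSpace.Completion.denseRange_coe
    (UniformSpace.Completion.isUniformInducing_coe _) t

theorem lift_tmul (f : E →ₗ[ℂ] F →ₗ[ℂ] G) (C : ℝ) (hf : ∀ e x, ‖f e x‖ ≤ C * (‖e‖ * ‖x‖))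
    (e : E) (x : F) : lift f C hf (tmul e x) = f e x :=
  lift_coe f C hf _

theorem norm_lift_le (f : E →ₗ[ℂ] F →ₗ[ℂ] G) (C : ℝ) (hC : 0 ≤ C)
    (hf : ∀ e x, ‖f e x‖ ≤ C * (‖e‖ * ‖x‖)) (t : ComplProjTensor E F) :
    ‖lift f C hf t‖ ≤ C * ‖t‖ := by
  induction t using UniformSpace.Completion.induction_on with
  | hp =>
    exact isClosed_le (lift f C hf).continuous.norm (continuous_const.mul continuous_norm)
  | ih t =>
    rw [lift_coe, UniformSpace.Completion.norm_coe]
    exact (ProjTensor.liftAlg f C hf).le_of_opNorm_le (LinearMap.mkContinuous_norm_le _ hC _) t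

end ComplProjTensor

/-! ### Banach algebras and Banach modules -/

/-- The product `r₀ r₁ ⋯ rₙ` of the first `n + 1` terms of a sequence. -/
def seqProd {R : Type*} [Mul R] (r : ℕ → R) : ℕ → R
  | 0 => r 0
  | n + 1 => seqProd r n * r (n + 1)

/-- `nilpotencyRate R n` is the supremum of `‖r₀ r₁ ⋯ rₙ‖ ^ (1 / (n + 1))` over `r₀, …, rₙ`
in the closed unit ball of `R`; there are `n + 1` factors. -/
def nilpotencyRate (R : Type*) [NonUnitalNormedRing R] (n : ℕ) : ℝ :=
  sSup {t : ℝ | ∃ r : ℕ → R, (∀ i, ‖r i‖ ≤ 1) ∧ t = ‖seqProd r n‖ ^ (1 / ((n : ℝ) + 1))}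

/-- `R` is topologically nilpotent. -/
def IsTopNilpotentAlgebra (R : Type*) [NonUnitalNormedRing R] : Prop :=
  Filter.Tendsto (nilpotencyRate R) Filter.atTop (nhds 0)

/-- A left Banach module over the (not necessarily unital) normed algebra `R`: a complex Banach
space with a bilinear, associative, contractive left action of `R`. -/
structure LeftBanachModule (R : Type u) [NonUnitalNormedRing R] [NormedSpace ℂ R] where
  carrier : Type u
  [normed : NormedAddCommGroup carrier]
  [space : NormedSpace ℂ carrier]
  [complete : CompleteSpace carrier]
  act : R →ₗ[ℂ] carrier →ₗ[ℂ] carrier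
  act_mul : ∀ r s x, act (r * s) x = act r (act s x)
  norm_act_le : ∀ r x, ‖act r x‖ ≤ ‖r‖ * ‖x‖

namespace LeftBanachModule

attribute [instance] normed space complete

section Basic

variable {R : Type u} [NonUnitalNormedRing R] [NormedSpace ℂ R]

instance : CoeSort (LeftBanachModule R) (Type u) := ⟨carrier⟩

/-- A morphism of left Banach modules: a bounded linear map that commutes with the action. -/
structure Hom (X Y : LeftBanachModule R) where
  toCLM : X →L[ℂ] Y
  map_act : ∀ r x, toCLM (X.act r x) = Y.act r (toCLM x)

instance (X Y : LeftBanachModule R) : CoeFun (Hom X Y) (fun _ => X → Y) := ⟨fun f => f.toCLM⟩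

/-- A morphism `ψ : X₀ → X` is small if every morphism `φ : Y → X` for which
`Y ⊕ X₀ → X, (y, z) ↦ φ y + ψ z` is surjective is itself surjective. -/
def IsSmall {X₀ X : LeftBanachModule R} (ψ : Hom X₀ X) : Prop :=
  ∀ (Y : LeftBanachModule R) (φ : Hom Y X),
    Function.Surjective (fun p : Y × X₀ => φ p.1 + ψ p.2) → Function.Surjective φ

/-- `P` is strictly projective if every surjective morphism onto `P` has a right inverse
morphism. -/
def IsStrictlyProjective (P : LeftBanachModule R) : Prop :=
  ∀ (Y : LeftBanachModule R) (ε : Hom Y P), Function.Surjective ε →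
    ∃ ρ : Hom P Y, ∀ x, ε (ρ x) = x

end Basic

/-! ### The module `R ⊗̂_R X` and the multiplication morphism -/

variable {R : Type u} [NonUnitalNormedRing R] [NormedSpace ℂ R]

/-- The closed linear span in `R ⊗̂ X` of the elements `r a ⊗ x - r ⊗ a x`. -/
def relations (X : LeftBanachModule R) : Submodule ℂ (ComplProjTensor R X) :=
  (Submodule.span ℂ {t | ∃ (r a : R) (x : X),
    t = ComplProjTensor.tmul (r * a) x - ComplProjTensor.tmul r (X.act a x)}).topologicalClosure

instance (X : LeftBanachModule R) : IsClosed (X.relations : Set (ComplProjTensor R X)) :=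
  Submodule.isClosed_topologicalClosure _

/-- A bounded linear map that kills the elements `r a ⊗ x - r ⊗ a x` kills `relations`. -/
theorem relations_le_ker (X : LeftBanachModule R) {G : Type*} [NormedAddCommGroup G]
    [NormedSpace ℂ G] (T : ComplProjTensor R X →L[ℂ] G)
    (h : ∀ (r a : R) (x : X), T (ComplProjTensor.tmul (r * a) x)
      = T (ComplProjTensor.tmul r (X.act a x))) :
    X.relations ≤ LinearMap.ker T.toLinearMap := by
  refine Submodule.topologicalClosure_minimal _ (Submodule.span_le.2 ?_) T.isClosed_ker
  rintro _ ⟨r, a, x, rfl⟩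
  change T _ = 0
  rw [map_sub, h, sub_self]

/-- The underlying Banach space of `R ⊗̂_R X`: the quotient of `R ⊗̂ X` by the closed linear span
of the elements `r a ⊗ x - r ⊗ a x`, with the quotient norm. -/
abbrev BalancedTensor (X : LeftBanachModule R) : Type u := ComplProjTensor R X ⧸ X.relations

variable [IsScalarTower ℂ R R] [SMulCommClass ℂ R R]

/-- The operator `s ⊗ x ↦ r s ⊗ x` on `R ⊗̂ X`. -/
def leftMul (X : LeftBanachModule R) (r : R) : ComplProjTensor R X →L[ℂ] ComplProjTensor R X :=
  ComplProjTensor.lift (ComplProjTensor.tmul ∘ₗ LinearMap.mulLeft ℂ r) ‖r‖ (fun s x =>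
    (ComplProjTensor.norm_tmul_le (r * s) x).trans (by
      rw [← mul_assoc]
      exact mul_le_mul_of_nonneg_right (norm_mul_le r s) (norm_nonneg x)))

theorem leftMul_tmul (X : LeftBanachModule R) (r s : R) (x : X) :
    X.leftMul r (ComplProjTensor.tmul s x) = ComplProjTensor.tmul (r * s) x :=
  ComplProjTensor.lift_tmul _ _ _ s x

theorem norm_leftMul_le (X : LeftBanachModule R) (r : R) (t : ComplProjTensor R X) :
    ‖X.leftMul r t‖ ≤ ‖r‖ * ‖t‖ :=
  ComplProjTensor.norm_lift_le _ _ (norm_nonneg r) _ t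

theorem relations_le_comap (X : LeftBanachModule R) (r : R) :
    X.relations ≤ X.relations.comap (X.leftMul r).toLinearMap := by
  have h := X.relations_le_ker (X.relations.mkQL ∘L X.leftMul r) (fun s a x => by
    simp only [ContinuousLinearMap.comp_apply, leftMul_tmul]
    refine (Submodule.Quotient.eq _).2 (Submodule.le_topologicalClosure _
      (Submodule.subset_span ⟨r * s, a, x, ?_⟩))
    rw [mul_assoc])
  intro t ht
  exact (Submodule.Quotient.mk_eq_zero X.relations).1 (h ht)

/-- `R ⊗̂_R X` as a left Banach `R`-module, with action `r · (s ⊗ x) = r s ⊗ x`. -/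
def balancedTensor (X : LeftBanachModule R) : LeftBanachModule R where
  carrier := BalancedTensor X
  act :=
    { toFun := fun r =>
        X.relations.mapQ X.relations (X.leftMul r).toLinearMap (X.relations_le_comap r)
      map_add' := fun r s => by
        have h : X.leftMul (r + s) = X.leftMul r + X.leftMul s :=
          ComplProjTensor.hom_ext fun a x => by
            simp [leftMul_tmul, add_mul]
        ext t
        simp [h]
      map_smul' := fun c r => by
        have h : X.leftMul (c • r) = c • X.leftMul r :=
          ComplProjTensor.hom_ext fun a x => by
            simp [leftMul_tmul, smul_mul_assoc]
        ext t
        simp [h] }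
  act_mul := fun r s x => by
    have h : X.leftMul (r * s) = X.leftMul r ∘L X.leftMul s :=
      ComplProjTensor.hom_ext fun a x => by
        simp [leftMul_tmul, mul_assoc]
    obtain ⟨t, rfl⟩ := Submodule.Quotient.mk_surjective _ x
    simp [h]
  norm_act_le := fun r x => by
    refine le_of_forall_pos_le_add fun δ hδ => ?_
    have hε : 0 < δ / (‖r‖ + 1) := by positivity
    obtain ⟨t, rfl, ht⟩ := Submodule.Quotient.norm_mk_lt x hε
    calc ‖(Submodule.Quotient.mk (X.leftMul r t) : BalancedTensor X)‖
        ≤ ‖X.leftMul r t‖ := Submodule.Quotient.norm_mk_le _ _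
      _ ≤ ‖r‖ * ‖t‖ := X.norm_leftMul_le r t
      _ ≤ ‖r‖ * (‖(Submodule.Quotient.mk t : BalancedTensor X)‖ + δ / (‖r‖ + 1)) := by gcongr
      _ ≤ ‖r‖ * ‖(Submodule.Quotient.mk t : BalancedTensor X)‖ + δ := by
        rw [mul_add]
        gcongr
        rw [mul_div_assoc', div_le_iff₀ (by positivity)]
        nlinarith [norm_nonneg r]

/-- The elementary tensor `r ⊗ x` in `R ⊗̂_R X`. -/
def balancedTmul (X : LeftBanachModule R) (r : R) (x : X) : X.balancedTensor :=
  (Submodule.Quotient.mk (ComplProjTensor.tmul r x) : BalancedTensor X)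

/-- The bounded linear map `R ⊗̂ X → X, r ⊗ x ↦ r · x`. -/
def mulCLM (X : LeftBanachModule R) : ComplProjTensor R X →L[ℂ] X :=
  ComplProjTensor.lift X.act 1 (fun r x => by rw [one_mul]; exact X.norm_act_le r x)

theorem mulCLM_tmul (X : LeftBanachModule R) (r : R) (x : X) :
    X.mulCLM (ComplProjTensor.tmul r x) = X.act r x :=
  ComplProjTensor.lift_tmul _ _ _ r x

/-- The action of a fixed element `r` as a bounded operator. -/
def actCLM (X : LeftBanachModule R) (r : R) : X →L[ℂ] X :=
  (X.act r).mkContinuous ‖r‖ (X.norm_act_le r)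

/-- The morphism of left Banach modules `R ⊗̂_R X → X, r ⊗ x ↦ r · x`. -/
def mulHom (X : LeftBanachModule R) : Hom X.balancedTensor X where
  toCLM := X.relations.liftQL X.mulCLM (X.relations_le_ker _ fun r a x => by
    rw [mulCLM_tmul, mulCLM_tmul, X.act_mul])
  map_act := fun r t => by
    have h : X.mulCLM ∘L X.leftMul r = X.actCLM r ∘L X.mulCLM :=
      ComplProjTensor.hom_ext fun s x => by
        simp only [ContinuousLinearMap.comp_apply, leftMul_tmul, mulCLM_tmul, X.act_mul]
        rfl
    obtain ⟨t, rfl⟩ := Submodule.Quotient.mk_surjective _ t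
    exact congrArg (fun T => T t) h

theorem mulHom_tmul (X : LeftBanachModule R) (r : R) (x : X) :
    X.mulHom (X.balancedTmul r x) = X.act r x :=
  X.mulCLM_tmul r x

end LeftBanachModule

end

/-! (1) ⇒ (2) is a duality argument. If `φ : Y → X` and the multiplication morphism are jointly
onto, the open mapping theorem gives `C` such that a functional `g` with `|g (a x)| ≤ D ‖x‖` for all
`‖a‖ ≤ 1` satisfies `‖g‖ ≤ C (‖g ∘ φ‖ + D)`. For `p` in the unit ball, `x ↦ g (p x)` composed with
`φ` has norm at most `‖g ∘ φ‖`, because `φ` commutes with the action. So the estimate iterates: `‖g‖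
≤ K ‖g ∘ φ‖ + C ^ (n + 1) D`, where `D` now bounds `g` on products of `n + 1` ring elements with a
vector (`exists_norm_le_of_seqProd`). Topological nilpotency makes `C ^ (n + 1) D` at most `‖g‖ / 2`
for a suitable `n`; hence the adjoint of `φ` is bounded below and `φ` is onto
(`surjective_of_norm_le_comp`).

(2) ⇒ (3) is immediate. For (3) ⇒ (1), fix `c > 0` and take the free module on pairs `(r, k)`, with
`r` a sequence in the unit ball and `k` a natural number. It is strictly projective. The map `e (r,
k) ↦ e (r, k) - c r_k e (r, k + 1)` differs from the identity by a morphism that factors through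
multiplication, so smallness makes it onto (`exists_surjective_of_isSmall`). A preimage of `e (r,
0)` must have the coordinates `c ^ (n + 1) r_0 ⋯ r_n` (`coord_of_shift`), and the open mapping
theorem bounds these uniformly in `r` and `n`. As `c` is arbitrary, `R` is topologically nilpotent.
-/

/-! ### Surjectivity of bounded operators by duality. -/

namespace ContinuousLinearMap

variable {E F : Type*} [NormedAddCommGroup E] [NormedSpace ℂ E] [NormedAddCommGroup F]
  [NormedSpace ℂ F]

/-- A bounded operator whose domain is complete and that solves every equation up to half the norm
of the right hand side, with control of the solution, is surjective. -/
theorem surjective_of_approx [CompleteSpace E] (φ : E →L[ℂ] F) (C : ℝ)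
    (h : ∀ x, ∃ y, ‖x - φ y‖ ≤ 1 / 2 * ‖x‖ ∧ ‖y‖ ≤ C * ‖x‖) : Function.Surjective φ := by
  choose g hg hgC using h
  intro x
  -- The residual after one correction. Its iterates decay geometrically, so the corrections sum in
  -- `E`, and their images telescope to `x`.
  set r : F → F := fun x => x - φ (g x) with hr
  have hC : ∀ x : F, C * ‖x‖ ≤ |C| * ‖x‖ := fun x =>
    mul_le_mul_of_nonneg_right (le_abs_self C) (norm_nonneg x)
  have hrn : ∀ n : ℕ, ‖r^[n] x‖ ≤ (1 / 2) ^ n * ‖x‖ := by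
    intro n
    induction n with
    | zero => simp
    | succ n ih =>
      rw [Function.iterate_succ_apply', pow_succ', mul_assoc]
      exact (hg _).trans (mul_le_mul_of_nonneg_left ih (by norm_num))
  have hs : Summable fun n : ℕ => g (r^[n] x) := by
    refine Summable.of_norm_bounded
      ((summable_geometric_two).mul_right (|C| * ‖x‖)) fun n => ?_
    refine ((hgC _).trans (hC _)).trans ?_
    calc |C| * ‖r^[n] x‖ ≤ |C| * ((1 / 2) ^ n * ‖x‖) := by gcongr; exact hrn n
      _ = (1 / 2) ^ n * (|C| * ‖x‖) := by ring
  refine ⟨∑' n, g (r^[n] x), ?_⟩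
  have hsum : ∀ n : ℕ, φ (∑ i ∈ Finset.range n, g (r^[i] x)) = x - r^[n] x := by
    intro n
    induction n with
    | zero => simp
    | succ n ih =>
      rw [Finset.sum_range_succ, map_add, ih, Function.iterate_succ_apply']
      generalize r^[n] x = z
      change x - z + φ (g z) = x - (z - φ (g z))
      abel
  have h0 : Filter.Tendsto (fun n => r^[n] x) Filter.atTop (nhds 0) := by
    refine squeeze_zero_norm hrn ?_
    simpa using (tendsto_pow_atTop_nhds_zero_of_lt_one (r := (1 / 2 : ℝ))
      (by norm_num) (by norm_num)).mul_const ‖x‖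
  have h1 := (φ.continuous.tendsto _).comp hs.hasSum.tendsto_sum_nat
  refine tendsto_nhds_unique h1 ?_
  have h2 : (φ ∘ fun n => ∑ i ∈ Finset.range n, g (r^[i] x)) = fun n => x - r^[n] x :=
    funext hsum
  rw [h2]
  simpa using h0.const_sub x

/-- A functional whose real part is at most `u` on the ball of radius `M` has norm at most
`u / M`. -/
theorem norm_mul_le_of_re_le (f : E →L[ℂ] ℂ) {M u : ℝ} (hM : 0 < M)
    (h : ∀ y, ‖y‖ ≤ M → (f y).re ≤ u) : ‖f‖ * M ≤ u := by
  have hu : 0 ≤ u := by simpa using h 0 (by simpa using hM.le)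
  rw [← le_div_iff₀ hM]
  refine f.opNorm_le_bound (by positivity) fun y => ?_
  rcases eq_or_ne (f y) 0 with h0 | h0
  · rw [h0, norm_zero]; positivity
  have hy : 0 < ‖y‖ := norm_pos_iff.2 fun hy => h0 (by rw [hy, map_zero])
  have hfy : 0 < ‖f y‖ := norm_pos_iff.2 h0
  -- This scalar brings `y` to norm `M` and rotates it so that `f` is real and positive there.
  set c : ℂ := ((M / ‖y‖ / ‖f y‖ : ℝ) : ℂ) * (starRingEnd ℂ) (f y) with hc
  have h1 : (f (c • y)).re = M / ‖y‖ * ‖f y‖ := by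
    have : f (c • y) = ((M / ‖y‖ * ‖f y‖ : ℝ) : ℂ) := by
      rw [map_smul, smul_eq_mul, hc, mul_assoc, mul_comm ((starRingEnd ℂ) (f y)), Complex.mul_conj,
        Complex.normSq_eq_norm_sq, ← Complex.ofReal_mul]
      congr 1
      field_simp
    rw [this, Complex.ofReal_re]
  have h2 : ‖c • y‖ ≤ M := by
    rw [norm_smul, hc, norm_mul, Complex.norm_real, RCLike.norm_conj, Real.norm_of_nonneg
      (by positivity)]
    apply le_of_eq
    field_simp
  have h3 := h _ h2
  rw [h1] at h3
  rw [div_mul_eq_mul_div, le_div_iff₀ hM]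
  calc ‖f y‖ * M = M / ‖y‖ * ‖f y‖ * ‖y‖ := by field_simp
    _ ≤ u * ‖y‖ := by gcongr

/-- A bounded operator between Banach spaces whose adjoint is bounded below is surjective. -/
theorem surjective_of_norm_le_comp [CompleteSpace E] (φ : E →L[ℂ] F) {K : ℝ} (hK : 0 < K)
    (h : ∀ f : F →L[ℂ] ℂ, ‖f‖ ≤ K * ‖f ∘L φ‖) : Function.Surjective φ := by
  refine φ.surjective_of_approx K fun x => ?_
  rcases eq_or_ne x 0 with rfl | hx
  · exact ⟨0, by simp⟩
  have hx' : 0 < ‖x‖ := norm_pos_iff.2 hx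
  have hM : 0 < K * ‖x‖ := by positivity
  -- Otherwise Hahn–Banach separates `x` from this convex set, and `‖f ∘ φ‖ K ‖x‖ ≤ u < Re (f x) ≤
  -- ‖f‖ ‖x‖` contradicts the lower bound on the adjoint.
  have hmem : x ∈ closure (φ '' Metric.closedBall 0 (K * ‖x‖)) := by
    by_contra hx0
    have hconv : Convex ℝ (φ '' Metric.closedBall 0 (K * ‖x‖)) :=
      (convex_closedBall (0 : E) _).linear_image (φ.restrictScalars ℝ).toLinearMap
    obtain ⟨f, u, hu, hux⟩ := RCLike.geometric_hahn_banach_closed_point (𝕜 := ℂ)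
      hconv.closure isClosed_closure hx0
    have h1 : ‖f ∘L φ‖ * (K * ‖x‖) ≤ u := norm_mul_le_of_re_le _ hM fun y hy =>
      (hu _ (subset_closure ⟨y, by simpa using hy, rfl⟩)).le
    have h2 : (f x).re ≤ ‖f x‖ := Complex.re_le_norm _
    have h3 : ‖f x‖ ≤ K * ‖f ∘L φ‖ * ‖x‖ := (f.le_opNorm x).trans (by gcongr; exact h f)
    have h4 : u < (f x).re := hux
    nlinarith
  obtain ⟨_, ⟨y, hy, rfl⟩, hd⟩ := Metric.mem_closure_iff.1 hmem (1 / 2 * ‖x‖) (by positivity)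
  exact ⟨y, by rw [← dist_eq_norm]; exact hd.le, by simpa using hy⟩

end ContinuousLinearMap

/-! ### Products of sequences -/

theorem seqProd_congr {R : Type*} [Mul R] {r s : ℕ → R} {n : ℕ} (h : ∀ i ≤ n, r i = s i) :
    seqProd r n = seqProd s n := by
  induction n with
  | zero => exact h 0 le_rfl
  | succ n ih =>
    change seqProd r n * r (n + 1) = seqProd s n * s (n + 1)
    rw [ih fun i hi => h i (by omega), h (n + 1) le_rfl]

theorem norm_seqProd_le_one {R : Type*} [NonUnitalNormedRing R] {r : ℕ → R} (h : ∀ i, ‖r i‖ ≤ 1)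
    (n : ℕ) : ‖seqProd r n‖ ≤ 1 := by
  induction n with
  | zero => exact h 0
  | succ n ih => exact (norm_mul_le _ _).trans (mul_le_one₀ ih (norm_nonneg _) (h _))

theorem nilpotencyRate_nonneg (R : Type*) [NonUnitalNormedRing R] (n : ℕ) :
    0 ≤ nilpotencyRate R n :=
  Real.sSup_nonneg (by rintro _ ⟨r, -, rfl⟩; positivity)

theorem norm_seqProd_le_pow {R : Type*} [NonUnitalNormedRing R] {r : ℕ → R} (h : ∀ i, ‖r i‖ ≤ 1)
    (n : ℕ) : ‖seqProd r n‖ ≤ nilpotencyRate R n ^ (n + 1) := by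
  have hb : BddAbove {t : ℝ | ∃ r : ℕ → R, (∀ i, ‖r i‖ ≤ 1) ∧
      t = ‖seqProd r n‖ ^ (1 / ((n : ℝ) + 1))} := by
    refine ⟨1, ?_⟩
    rintro _ ⟨r, hr, rfl⟩
    exact Real.rpow_le_one (norm_nonneg _) (norm_seqProd_le_one hr n) (by positivity)
  have h1 : ‖seqProd r n‖ ^ (1 / ((n : ℝ) + 1)) ≤ nilpotencyRate R n := le_csSup hb ⟨r, h, rfl⟩
  calc ‖seqProd r n‖ = (‖seqProd r n‖ ^ (1 / ((n : ℝ) + 1))) ^ (n + 1) := by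
        rw [← Real.rpow_natCast, ← Real.rpow_mul (norm_nonneg _)]
        push_cast
        rw [one_div_mul_cancel (by positivity), Real.rpow_one]
    _ ≤ _ := by gcongr

/-- Taking roots gives a rate of at most `K ^ (1 / (n + 1)) / c` when `K > 0`, which tends to `1 /
c`; and `c` is arbitrary. -/
theorem isTopNilpotentAlgebra_of_bound {R : Type*} [NonUnitalNormedRing R]
    (h : ∀ c : ℝ, 0 < c → ∃ K : ℝ, ∀ r : ℕ → R, (∀ i, ‖r i‖ ≤ 1) → ∀ n,
      c ^ (n + 1) * ‖seqProd r n‖ ≤ K) : IsTopNilpotentAlgebra R := by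
  refine Metric.tendsto_atTop.2 fun ε hε => ?_
  obtain ⟨K, hK⟩ := h (2 / ε) (by positivity)
  -- The bound `K` may be zero, and `L ^ (1 / (n + 1)) → 1` needs a nonzero base.
  set L : ℝ := max K 1 with hL
  have hL0 : 0 < L := lt_max_of_lt_right one_pos
  have ht : Filter.Tendsto (fun n : ℕ => L ^ (1 / ((n : ℝ) + 1)) * (ε / 2)) Filter.atTop
      (nhds (L ^ (0 : ℝ) * (ε / 2))) :=
    (tendsto_const_nhds.rpow tendsto_one_div_add_atTop_nhds_zero_nat
      (Or.inl hL0.ne')).mul_const _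
  rw [Real.rpow_zero, one_mul] at ht
  obtain ⟨N, hN⟩ := Filter.eventually_atTop.1 (ht.eventually_lt_const (half_lt_self hε))
  refine ⟨N, fun n hn => ?_⟩
  rw [Real.dist_eq, sub_zero, abs_of_nonneg (nilpotencyRate_nonneg R n)]
  refine lt_of_le_of_lt (Real.sSup_le ?_ (by positivity)) (hN n hn)
  rintro _ ⟨r, hr, rfl⟩
  have h1 : ‖seqProd r n‖ ≤ L * (ε / 2) ^ (n + 1) := by
    have h2 := (hK r hr n).trans (le_max_left K 1)
    calc ‖seqProd r n‖ = ((2 / ε) ^ (n + 1) * ‖seqProd r n‖) * (ε / 2) ^ (n + 1) := by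
          rw [mul_right_comm, ← mul_pow]
          field_simp
          simp
      _ ≤ _ := by gcongr
  calc ‖seqProd r n‖ ^ (1 / ((n : ℝ) + 1))
      ≤ (L * (ε / 2) ^ (n + 1)) ^ (1 / ((n : ℝ) + 1)) := by gcongr
    _ = L ^ (1 / ((n : ℝ) + 1)) * (ε / 2) := by
      rw [Real.mul_rpow hL0.le (by positivity), ← Real.rpow_natCast,
        ← Real.rpow_mul (by positivity)]
      push_cast
      rw [mul_one_div_cancel (by positivity), Real.rpow_one]

/-! ### Topological nilpotency implies smallness. -/

namespace LeftBanachModule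

variable {R : Type u} [NonUnitalNormedRing R] [NormedSpace ℂ R]

theorem actCLM_apply (X : LeftBanachModule R) (r : R) (x : X) : X.actCLM r x = X.act r x := rfl

theorem norm_actCLM_le (X : LeftBanachModule R) (r : R) : ‖X.actCLM r‖ ≤ ‖r‖ :=
  LinearMap.mkContinuous_norm_le _ (norm_nonneg r) _

variable [IsScalarTower ℂ R R] [SMulCommClass ℂ R R]

/-- A functional that is bounded by `D` on products `a · x` of elements of the unit balls is
bounded by `D` after composition with `R ⊗̂ X → X`. -/
theorem norm_apply_mulCLM_le (X : LeftBanachModule R) (g : X →L[ℂ] ℂ) {D : ℝ}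
    (h : ∀ a : R, ‖a‖ ≤ 1 → ∀ x, ‖g (X.act a x)‖ ≤ D * ‖x‖) (hD : 0 ≤ D)
    (t : ComplProjTensor R X) : ‖g (X.mulCLM t)‖ ≤ D * ‖t‖ := by
  have hb : ∀ (r : R) (x : X), ‖X.act.compr₂ g.toLinearMap r x‖ ≤ D * (‖r‖ * ‖x‖) := by
    intro r x
    change ‖g (X.act r x)‖ ≤ _
    rcases eq_or_ne r 0 with rfl | hr
    · simp
    have hr' : (‖r‖ : ℂ) ≠ 0 := by simpa using hr
    -- Homogeneity extends the bound from the unit ball to all of `R`.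
    have h1 := h ((‖r‖ : ℂ)⁻¹ • r) (by
      rw [norm_smul, norm_inv, Complex.norm_real, norm_norm, inv_mul_cancel₀ (norm_ne_zero_iff.2 hr)])
      x
    have h2 : X.act r x = (‖r‖ : ℂ) • X.act ((‖r‖ : ℂ)⁻¹ • r) x := by
      rw [map_smul, LinearMap.smul_apply, smul_inv_smul₀ hr']
    rw [h2, map_smul, norm_smul, Complex.norm_real, norm_norm]
    calc _ ≤ ‖r‖ * (D * ‖x‖) := by gcongr
      _ = _ := by ring
  have heq : g ∘L X.mulCLM = ComplProjTensor.lift (X.act.compr₂ g.toLinearMap) D hb :=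
    ComplProjTensor.hom_ext fun r x => by
      rw [ComplProjTensor.lift_tmul, ContinuousLinearMap.comp_apply, mulCLM_tmul]
      rfl
  have := ComplProjTensor.norm_lift_le _ _ hD hb t
  rwa [← heq] at this

/-- If `φ` and the multiplication morphism are jointly onto, then every functional is controlled
by its composition with `φ` and by its values on `R · X`. -/
theorem exists_norm_le_of_surjective {X Y : LeftBanachModule R} (φ : Hom Y X)
    (h : Function.Surjective fun p : Y × X.balancedTensor => φ p.1 + X.mulHom p.2) :
    ∃ C > 0, ∀ (g : X →L[ℂ] ℂ) (D : ℝ), 0 ≤ D →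
      (∀ a : R, ‖a‖ ≤ 1 → ∀ x, ‖g (X.act a x)‖ ≤ D * ‖x‖) →
      ∀ x, ‖g x‖ ≤ C * (‖g ∘L φ.toCLM‖ + D) * ‖x‖ := by
  -- Lifting from the balanced quotient to `R ⊗̂ X` keeps surjectivity and lets
  -- `norm_apply_mulCLM_le` apply directly. The product carries the max norm, so both components of
  -- a preimage are controlled.
  set T : (Y × ComplProjTensor R X) →L[ℂ] X := φ.toCLM.coprod X.mulCLM with hT
  have hs : Function.Surjective T := by
    intro x
    obtain ⟨⟨y, z⟩, hx⟩ := h x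
    obtain ⟨t, rfl⟩ := Submodule.Quotient.mk_surjective _ z
    exact ⟨(y, t), hx⟩
  obtain ⟨C, hC, hpre⟩ := T.exists_preimage_norm_le hs
  refine ⟨C, hC, fun g D hD hg x => ?_⟩
  obtain ⟨⟨y, t⟩, rfl, hyt⟩ := hpre x
  have h1 : ‖(g ∘L φ.toCLM) y‖ ≤ ‖g ∘L φ.toCLM‖ * (C * ‖T (y, t)‖) :=
    ((g ∘L φ.toCLM).le_opNorm y).trans (by gcongr; exact (le_max_left _ _).trans hyt)
  have h2 : ‖g (X.mulCLM t)‖ ≤ D * (C * ‖T (y, t)‖) :=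
    (X.norm_apply_mulCLM_le g hg hD t).trans (by gcongr; exact (le_max_right _ _).trans hyt)
  calc ‖g (T (y, t))‖ = ‖(g ∘L φ.toCLM) y + g (X.mulCLM t)‖ := by
        rw [hT, ContinuousLinearMap.coprod_apply, map_add]; rfl
    _ ≤ _ := norm_add_le _ _
    _ ≤ _ := add_le_add h1 h2
    _ = _ := by ring

/-- The iterated form of `exists_norm_le_of_surjective`, for products of `n + 1` elements. -/
theorem exists_norm_le_of_seqProd {X Y : LeftBanachModule R} (φ : Hom Y X) {C : ℝ} (hC : 0 < C)
    (h : ∀ (g : X →L[ℂ] ℂ) (D : ℝ), 0 ≤ D →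
      (∀ a : R, ‖a‖ ≤ 1 → ∀ x, ‖g (X.act a x)‖ ≤ D * ‖x‖) →
      ∀ x, ‖g x‖ ≤ C * (‖g ∘L φ.toCLM‖ + D) * ‖x‖) (n : ℕ) :
    ∃ K > 0, ∀ (g : X →L[ℂ] ℂ) (D : ℝ), 0 ≤ D →
      (∀ r : ℕ → R, (∀ i, ‖r i‖ ≤ 1) → ∀ x, ‖g (X.act (seqProd r n) x)‖ ≤ D * ‖x‖) →
      ∀ x, ‖g x‖ ≤ (K * ‖g ∘L φ.toCLM‖ + C ^ (n + 1) * D) * ‖x‖ := by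
  induction n with
  | zero =>
    refine ⟨C, hC, fun g D hD hg x => (h g D hD (fun a ha => hg (fun _ => a) fun _ => ha) x).trans
      (le_of_eq (by ring))⟩
  | succ n ih =>
    obtain ⟨K, hK, hKb⟩ := ih
    -- The induction hypothesis is used with `C (‖g ∘ φ‖ + D)` in place of `D`; its `‖g ∘ φ‖` term
    -- adds `C ^ (n + 1) * C` to `K`.
    refine ⟨K + C ^ (n + 1) * C, by positivity, fun g D hD hg x => ?_⟩
    refine (hKb g (C * (‖g ∘L φ.toCLM‖ + D)) (by positivity) (fun r hr x => ?_) x).trans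
      (le_of_eq (by ring))
    set p := seqProd r n with hp
    have hp1 : ‖p‖ ≤ 1 := norm_seqProd_le_one hr n
    refine (h (g ∘L X.actCLM p) D hD (fun a ha x => ?_) x).trans ?_
    -- Only the entry at `n + 1` of the tail matters, but every entry must lie in the unit ball.
    · have h1 := hg (fun i => if i ≤ n then r i else a)
        (fun i => by split_ifs; exacts [hr i, ha]) x
      have h2 : seqProd (fun i => if i ≤ n then r i else a) (n + 1) = p * a := by
        change seqProd _ n * _ = _
        rw [seqProd_congr (s := r) fun i hi => if_pos hi]
        simp [hp]
      rwa [h2, X.act_mul] at h1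
    · have h3 : (g ∘L X.actCLM p) ∘L φ.toCLM = (g ∘L φ.toCLM) ∘L Y.actCLM p := by
        ext y
        simp only [ContinuousLinearMap.comp_apply, actCLM_apply, φ.map_act]
      have h4 : ‖(g ∘L φ.toCLM) ∘L Y.actCLM p‖ ≤ ‖g ∘L φ.toCLM‖ :=
        (ContinuousLinearMap.opNorm_comp_le _ _).trans
          (mul_le_of_le_one_right (norm_nonneg _) ((Y.norm_actCLM_le p).trans hp1))
      rw [h3]
      gcongr

/-- Over a topologically nilpotent algebra the multiplication morphisms are small. -/
theorem isSmall_mulHom (hR : IsTopNilpotentAlgebra R) (X : LeftBanachModule R) :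
    IsSmall X.mulHom := by
  intro Y φ hsurj
  obtain ⟨C, hC, h⟩ := exists_norm_le_of_surjective φ hsurj
  -- With this `n` the error term is at most `‖f‖ / 2`; absorbing it on the left gives the constant
  -- `2 * K` below.
  obtain ⟨n, hn⟩ := (hR.eventually_lt_const (show 0 < 1 / (2 * C) by positivity)).exists
  obtain ⟨K, hK, hKb⟩ := exists_norm_le_of_seqProd φ hC h n
  refine φ.toCLM.surjective_of_norm_le_comp (K := 2 * K) (by positivity) fun f => ?_
  set q := nilpotencyRate R n with hq
  have hq0 : 0 ≤ q := nilpotencyRate_nonneg R n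
  have h1 : ‖f‖ ≤ K * ‖f ∘L φ.toCLM‖ + C ^ (n + 1) * (q ^ (n + 1) * ‖f‖) := by
    refine f.opNorm_le_bound (by positivity) (hKb f _ (by positivity) fun r hr x => ?_)
    calc ‖f (X.act (seqProd r n) x)‖ ≤ ‖f‖ * (‖seqProd r n‖ * ‖x‖) :=
          (f.le_opNorm _).trans (by gcongr; exact X.norm_act_le _ _)
      _ ≤ ‖f‖ * (q ^ (n + 1) * ‖x‖) := by gcongr; exact norm_seqProd_le_pow hr n
      _ = _ := by ring
  have h2 : C ^ (n + 1) * q ^ (n + 1) ≤ 1 / 2 := by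
    have h3 : C * q ≤ 1 / 2 := by
      calc C * q ≤ C * (1 / (2 * C)) := by gcongr
        _ = 1 / 2 := by field_simp
    rw [← mul_pow]
    calc (C * q) ^ (n + 1) ≤ (C * q) ^ 1 :=
          pow_le_pow_of_le_one (by positivity) (by linarith) (by omega)
      _ ≤ 1 / 2 := by rwa [pow_one]
  have h4 : C ^ (n + 1) * (q ^ (n + 1) * ‖f‖) ≤ 1 / 2 * ‖f‖ := by
    rw [← mul_assoc]
    gcongr
  linarith

end LeftBanachModule

/-! ### Unitization and free modules. -/

noncomputable section

namespace LeftBanachModule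

/-- The unitization of `R` with the `ℓ¹`-norm. -/
abbrev Unit1 (R : Type u) [NonUnitalNormedRing R] [NormedSpace ℂ R] : Type u :=
  WithLp 1 (Unitization ℂ R)

variable {R : Type u} [NonUnitalNormedRing R] [NormedSpace ℂ R]

/-- The element of the unitization given by `r`. -/
def inr1 (r : R) : Unit1 R := WithLp.toLp 1 (r : Unitization ℂ R)

theorem norm_inr1 (r : R) : ‖inr1 r‖ = ‖r‖ := WithLp.unitization_norm_inr r

/-- The action of the unitization of `R` on a left Banach `R`-module. -/
def unitAct (Y : LeftBanachModule R) (a : Unit1 R) (y : Y) : Y :=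
  a.ofLp.fst • y + Y.act a.ofLp.snd y

theorem norm_unitAct_le (Y : LeftBanachModule R) (a : Unit1 R) (y : Y) :
    ‖Y.unitAct a y‖ ≤ ‖a‖ * ‖y‖ := by
  rw [WithLp.unitization_norm_def, add_mul, ← norm_smul]
  exact (norm_add_le _ _).trans (add_le_add le_rfl (Y.norm_act_le _ _))

theorem unitAct_add (Y : LeftBanachModule R) (a b : Unit1 R) (y : Y) :
    Y.unitAct (a + b) y = Y.unitAct a y + Y.unitAct b y := by
  simp only [unitAct, WithLp.ofLp_add, Unitization.fst_add, Unitization.snd_add, add_smul, map_add,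
    LinearMap.add_apply]
  abel

theorem unitAct_smul (Y : LeftBanachModule R) (c : ℂ) (a : Unit1 R) (y : Y) :
    Y.unitAct (c • a) y = c • Y.unitAct a y := by
  simp only [unitAct, WithLp.ofLp_smul, Unitization.fst_smul, Unitization.snd_smul, smul_eq_mul,
    mul_smul, map_smul, LinearMap.smul_apply, smul_add]

theorem map_unitAct {Y Z : LeftBanachModule R} (f : Hom Y Z) (a : Unit1 R) (y : Y) :
    f (Y.unitAct a y) = Z.unitAct a (f y) := by
  simp only [unitAct, map_add, map_smul, f.map_act]

variable [IsScalarTower ℂ R R] [SMulCommClass ℂ R R]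

theorem unitAct_one (Y : LeftBanachModule R) (y : Y) : Y.unitAct (1 : Unit1 R) y = y := by
  have h1 : (1 : Unit1 R).ofLp = 1 := rfl
  simp [unitAct, h1]

/-- This compatibility makes `freeLift` commute with the action of `R`. -/
theorem unitAct_inr1_mul (Y : LeftBanachModule R) (r : R) (a : Unit1 R) (y : Y) :
    Y.unitAct (inr1 r * a) y = Y.act r (Y.unitAct a y) := by
  simp [unitAct, inr1, Y.act_mul]

/-- The free left Banach `R`-module `ℓ¹(S, R₊)`. -/
def free (R : Type u) [NonUnitalNormedRing R] [NormedSpace ℂ R] [IsScalarTower ℂ R R]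
    [SMulCommClass ℂ R R] [CompleteSpace R] (S : Type u) : LeftBanachModule R where
  carrier := lp (fun _ : S => Unit1 R) 1
  act := LinearMap.mk₂ ℂ (fun r x => inr1 r • x)
    (fun r s x => by
      rw [← add_smul]; congr 1; simp [inr1, ← WithLp.toLp_add])
    (fun c r x => by
      ext i : 2
      simp [inr1, WithLp.toLp_smul])
    (fun r x y => smul_add _ _ _)
    (fun c r x => by
      ext i : 2
      simp)
  act_mul := fun r s x => by
    change inr1 (r * s) • x = inr1 r • inr1 s • x
    rw [← mul_smul]
    congr 1
    exact congrArg (WithLp.toLp 1) (Unitization.inr_mul ℂ r s)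
  norm_act_le := fun r x => by
    rw [← norm_inr1]
    exact norm_smul_le (inr1 r) x

variable [CompleteSpace R] {S : Type u}

/-- The coordinates of an element of the free module. -/
def coord (s : S) : free R S →L[ℂ] Unit1 R := lp.evalCLM ℂ (fun _ : S => Unit1 R) 1 s

theorem coord_act (r : R) (x : free R S) (s : S) :
    coord s ((free R S).act r x) = inr1 r * coord s x := rfl

theorem norm_coord_le (s : S) (x : free R S) : ‖coord s x‖ ≤ ‖x‖ :=
  lp.norm_apply_le_norm one_ne_zero x s

theorem coord_ext {x y : free R S} (h : ∀ s, coord s x = coord s y) : x = y :=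
  lp.ext (funext h)

theorem hasSum_norm_coord (x : free R S) : HasSum (fun s => ‖coord s x‖) ‖x‖ := by
  have := lp.hasSum_norm (p := 1) (by simp) (x : lp (fun _ : S => Unit1 R) 1)
  simp only [ENNReal.toReal_one, Real.rpow_one] at this
  exact this

/-- The basis vectors of the free module. -/
def basis [DecidableEq S] (s : S) : free R S := lp.single 1 s (1 : Unit1 R)

theorem norm_basis_le [DecidableEq S] (s : S) : ‖(basis s : free R S)‖ ≤ 1 := by
  have h := lp.norm_single (p := 1) (E := fun _ : S => Unit1 R) one_pos s 1
  refine (le_of_eq h).trans ?_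
  rw [WithLp.unitization_norm_def]
  have h1 : (1 : Unit1 R).ofLp = 1 := rfl
  simp [h1]

theorem coord_basis [DecidableEq S] (s t : S) :
    coord t (basis s : free R S) = if t = s then 1 else 0 :=
  Pi.single_apply s (1 : Unit1 R) t

theorem coord_unitAct (a : Unit1 R) (x : free R S) (s : S) :
    coord s ((free R S).unitAct a x) = a * coord s x := by
  rw [unitAct, map_add, map_smul, coord_act]
  apply WithLp.ofLp_injective
  ext <;> simp [inr1, add_assoc]

/-- The `ℓ¹`-norm makes the basis expansion converge in norm, so a bounded operator is determined by
its values on multiples of basis vectors. -/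
theorem hasSum_unitAct_basis [DecidableEq S] (x : free R S) :
    HasSum (fun s => (free R S).unitAct (coord s x) (basis s)) x := by
  have h := lp.hasSum_single (p := 1) (by simp) (x : lp (fun _ : S => Unit1 R) 1)
  refine (congrArg (fun f => HasSum f x) (funext fun s => ?_)).mpr h
  refine coord_ext (R := R) (S := S) fun t => ?_
  rw [coord_unitAct, coord_basis]
  refine Eq.trans ?_ (Pi.single_apply s (coord s x) t).symm
  split_ifs <;> simp

/-- Bounded operators on the free module that agree on multiples of basis vectors are equal. -/
theorem free_clm_ext [DecidableEq S] {G : Type*} [NormedAddCommGroup G] [NormedSpace ℂ G]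
    {T U : free R S →L[ℂ] G}
    (h : ∀ a s, T ((free R S).unitAct a (basis s)) = U ((free R S).unitAct a (basis s)))
    (x : free R S) : T x = U x := by
  refine (T.hasSum (hasSum_unitAct_basis x)).unique ?_
  simp only [h]
  exact U.hasSum (hasSum_unitAct_basis x)

/-- Morphisms out of the free module that agree on the basis are equal. -/
theorem free_hom_ext [DecidableEq S] {Y : LeftBanachModule R} {f g : Hom (free R S) Y}
    (h : ∀ s, f (basis s) = g (basis s)) (x : free R S) : f x = g x :=
  free_clm_ext (T := f.toCLM) (U := g.toCLM)
    (fun a s => by rw [map_unitAct, map_unitAct, h]) x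

theorem summable_unitAct {Y : LeftBanachModule R} {y : S → Y} {C : ℝ} (hy : ∀ s, ‖y s‖ ≤ C)
    (x : free R S) : Summable fun s => Y.unitAct (coord s x) (y s) :=
  Summable.of_norm_bounded ((hasSum_norm_coord x).summable.mul_right C) fun s =>
    (Y.norm_unitAct_le _ _).trans (by gcongr; exact hy s)

/-- The morphism out of the free module with prescribed bounded values on the basis. -/
def freeLift {Y : LeftBanachModule R} (y : S → Y) (C : ℝ) (hy : ∀ s, ‖y s‖ ≤ C) :
    Hom (free R S) Y where
  toCLM := LinearMap.mkContinuous
    { toFun := fun x => ∑' s, Y.unitAct (coord s x) (y s)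
      map_add' := fun x x' => by
        simp only [map_add, unitAct_add]
        exact (summable_unitAct hy x).tsum_add (summable_unitAct hy x')
      map_smul' := fun c x => by
        simp only [map_smul, unitAct_smul, RingHom.id_apply]
        exact (summable_unitAct hy x).tsum_const_smul c } C (fun x => by
      refine tsum_of_norm_bounded (((hasSum_norm_coord x).mul_left C)) fun s => ?_
      refine (Y.norm_unitAct_le _ _).trans ?_
      rw [mul_comm]
      gcongr
      exact hy s)
  map_act := fun r x => by
    change ∑' s, Y.unitAct (coord s ((free R S).act r x)) (y s)
      = Y.actCLM r (∑' s, Y.unitAct (coord s x) (y s))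
    rw [(Y.actCLM r).map_tsum (summable_unitAct hy x)]
    refine tsum_congr fun s => ?_
    rw [coord_act, unitAct_inr1_mul, actCLM_apply]

theorem freeLift_basis [DecidableEq S] {Y : LeftBanachModule R} (y : S → Y) (C : ℝ)
    (hy : ∀ s, ‖y s‖ ≤ C) (s : S) : freeLift y C hy (basis s) = y s := by
  change ∑' t, Y.unitAct (coord t (basis s)) (y t) = y s
  rw [tsum_eq_single s, coord_basis, if_pos rfl, unitAct_one]
  intro t ht
  rw [coord_basis, if_neg ht]
  simp [unitAct]

/-- The open mapping theorem lifts the basis vectors along `ε` with uniformly bounded norms, which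
is what `freeLift` needs to define a section. -/
theorem isStrictlyProjective_free : (free R S).IsStrictlyProjective := by
  classical
  intro Y ε hε
  obtain ⟨C, hC, h⟩ := ε.toCLM.exists_preimage_norm_le hε
  choose g hg hgC using h
  let ρ : Hom (free R S) Y := freeLift (fun s => g (basis s)) C fun s =>
    (hgC _).trans (mul_le_of_le_one_right hC.le (norm_basis_le s))
  refine ⟨ρ, ?_⟩
  let e : Hom (free R S) (free R S) := ⟨ε.toCLM ∘L ρ.toCLM, fun r x => by
    simp only [ContinuousLinearMap.comp_apply, ρ.map_act, ε.map_act]⟩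
  let i : Hom (free R S) (free R S) := ⟨ContinuousLinearMap.id ℂ _, fun r x => rfl⟩
  refine free_hom_ext (f := e) (g := i) fun s => ?_
  change ε (ρ (basis s)) = basis s
  rw [freeLift_basis]
  exact hg _

/-! ### The shift morphisms -/

theorem norm_balancedTmul_le (X : LeftBanachModule R) (r : R) (x : X) :
    ‖X.balancedTmul r x‖ ≤ ‖r‖ * ‖x‖ :=
  (Submodule.Quotient.norm_mk_le _ _).trans (ComplProjTensor.norm_tmul_le r x)

/-- If the multiplication morphism of the free module on `S` is small, then for a self-map `σ` of
`S` and bounded coefficients `a`, the morphism `e s ↦ e s - a s • e (σ s)` is onto. -/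
theorem exists_surjective_of_isSmall [DecidableEq S] (h : IsSmall (free R S).mulHom)
    (σ : S → S) (a : S → R) (C : ℝ) (ha : ∀ s, ‖a s‖ ≤ C) :
    ∃ φ : Hom (free R S) (free R S), Function.Surjective φ ∧
      ∀ s, φ (basis s) = basis s - (free R S).act (a s) (basis (σ s)) := by
  let G : Hom (free R S) (free R S).balancedTensor :=
    freeLift (fun s => (free R S).balancedTmul (a s) (basis (σ s))) C fun s =>
      ((free R S).norm_balancedTmul_le _ _).trans
        ((mul_le_of_le_one_right (norm_nonneg _) (norm_basis_le _)).trans (ha s))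
  let φ : Hom (free R S) (free R S) :=
    ⟨ContinuousLinearMap.id ℂ _ - (free R S).mulHom.toCLM ∘L G.toCLM, fun r x => by
      simp only [sub_apply, ContinuousLinearMap.comp_apply, G.map_act,
        (free R S).mulHom.map_act, map_sub, ContinuousLinearMap.id_apply]⟩
  -- Since `φ` is the identity minus multiplication after `G`, the pair `(x, G x)` maps to `x`;
  -- joint surjectivity is automatic.
  refine ⟨φ, h _ φ fun x => ⟨(x, G x), sub_add_cancel x ((free R S).mulHom (G x))⟩, fun s => ?_⟩
  change basis s - (free R S).mulHom (G (basis s)) = _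
  rw [freeLift_basis, mulHom_tmul]

/-- Coordinates of a preimage of a basis vector under a shift morphism along `ℕ`. -/
theorem coord_of_shift {I : Type u} [DecidableEq (I × ℕ)] (a : I × ℕ → R)
    (φ : Hom (free R (I × ℕ)) (free R (I × ℕ)))
    (hφ : ∀ s, φ (basis s) = basis s - (free R _).act (a s) (basis (s.1, s.2 + 1))) (i : I)
    (b : free R (I × ℕ)) (hb : φ b = basis (i, 0)) (n : ℕ) :
    coord (i, n + 1) b = inr1 (seqProd (fun k => a (i, k)) n) := by
  have hterm (x : Unit1 R) (s t : I × ℕ) : coord t (φ ((free R _).unitAct x (basis s)))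
      = x * ((if t = s then 1 else 0) - inr1 (a s) * if t = (s.1, s.2 + 1) then 1 else 0) := by
    rw [map_unitAct, coord_unitAct, hφ, map_sub, coord_act, coord_basis, coord_basis]
  -- No shifted basis vector has second index `0`, so `φ` preserves this coordinate.
  have h0 : coord (i, 0) b = 1 := by
    have h1 : coord (i, 0) (φ b) = coord (i, 0) b := by
      change (coord (i, 0) ∘L φ.toCLM) b = _
      exact free_clm_ext (T := coord (i, 0) ∘L φ.toCLM) (U := coord (i, 0)) (fun x s => by
        rw [ContinuousLinearMap.comp_apply, hterm, coord_unitAct, coord_basis]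
        simp) b
    rw [← h1, hb, coord_basis, if_pos rfl]
  -- The coordinate of `φ b` at `(i, m + 1)` vanishes, and only the basis vectors at `(i, m + 1)`
  -- and `(i, m)` contribute to it. Coefficients act from the left, so `a (i, m)` appears on the
  -- right.
  have hstep : ∀ m, coord (i, m + 1) b = coord (i, m) b * inr1 (a (i, m)) := by
    intro m
    have h1 : coord (i, m + 1) (φ b) = coord (i, m + 1) b - coord (i, m) b * inr1 (a (i, m)) := by
      change (coord (i, m + 1) ∘L φ.toCLM) b = (coord (i, m + 1)
        - (ContinuousLinearMap.mul ℂ (Unit1 R)).flip (inr1 (a (i, m))) ∘L coord (i, m) :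
          free R (I × ℕ) →L[ℂ] Unit1 R) b
      exact free_clm_ext (T := coord (i, m + 1) ∘L φ.toCLM) (U := coord (i, m + 1)
        - (ContinuousLinearMap.mul ℂ (Unit1 R)).flip (inr1 (a (i, m))) ∘L coord (i, m))
        (fun x s => by
          rw [ContinuousLinearMap.comp_apply, hterm, sub_apply, ContinuousLinearMap.comp_apply,
            ContinuousLinearMap.flip_apply, ContinuousLinearMap.mul_apply', coord_unitAct,
            coord_unitAct, coord_basis, coord_basis, mul_sub]
          congr 1
          by_cases h : (i, m) = s
          · subst h
            simp
          · rw [if_neg h, if_neg fun h' => h (by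
              simp only [Prod.mk.injEq, add_left_inj] at h'
              exact Prod.ext h'.1 h'.2)]
            simp) b
    rw [hb, coord_basis, if_neg (by simp)] at h1
    exact sub_eq_zero.1 h1.symm
  induction n with
  | zero => rw [hstep, h0, one_mul]; rfl
  | succ n ih =>
    rw [hstep, ih]
    exact congrArg (WithLp.toLp 1) (Unitization.inr_mul ℂ _ _).symm

theorem seqProd_smul (c : ℂ) (r : ℕ → R) (n : ℕ) :
    seqProd (fun k => c • r k) n = c ^ (n + 1) • seqProd r n := by
  induction n with
  | zero => simp [seqProd]
  | succ n ih =>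
    change seqProd _ n * c • r (n + 1) = c ^ (n + 1 + 1) • (seqProd r n * r (n + 1))
    rw [ih, smul_mul_smul_comm, ← pow_succ]

/-- If the multiplication morphisms of all strictly projective modules are small, then the algebra
is topologically nilpotent. -/
theorem isTopNilpotentAlgebra_of_isSmall
    (h : ∀ P : LeftBanachModule R, P.IsStrictlyProjective → IsSmall P.mulHom) :
    IsTopNilpotentAlgebra R := by
  classical
  refine isTopNilpotentAlgebra_of_bound fun c hc => ?_
  -- All sequences are treated in one module, so that a single open mapping constant `K` serves
  -- every `r`.
  let I : Type u := {r : ℕ → R // ∀ i, ‖r i‖ ≤ 1}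
  let a : I × ℕ → R := fun s => (c : ℂ) • s.1.1 s.2
  have ha : ∀ s, ‖a s‖ ≤ c := fun s => by
    rw [norm_smul, Complex.norm_real, Real.norm_of_nonneg hc.le]
    exact mul_le_of_le_one_right hc.le (s.1.2 s.2)
  obtain ⟨φ, hφ, hφb⟩ := exists_surjective_of_isSmall (h _ (isStrictlyProjective_free (S := I × ℕ)))
    (fun s => (s.1, s.2 + 1)) a c ha
  obtain ⟨K, hK, hpre⟩ := φ.toCLM.exists_preimage_norm_le hφ
  refine ⟨K, fun r hr n => ?_⟩
  let i : I := ⟨r, hr⟩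
  obtain ⟨b, hb, hbK⟩ := hpre (basis (i, 0))
  have h1 := coord_of_shift a φ hφb i b hb n
  calc c ^ (n + 1) * ‖seqProd r n‖ = ‖inr1 (seqProd (fun k => a (i, k)) n)‖ := by
        rw [norm_inr1, seqProd_smul, norm_smul, norm_pow, Complex.norm_real,
          Real.norm_of_nonneg hc.le]
    _ ≤ ‖b‖ := h1 ▸ norm_coord_le _ b
    _ ≤ K := hbK.trans (mul_le_of_le_one_right hK.le (norm_basis_le _))

end LeftBanachModule

end

theorem mainTheorem10 {R : Type u} [NonUnitalNormedRing R] [NormedSpace ℂ R]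
    [IsScalarTower ℂ R R] [SMulCommClass ℂ R R] [CompleteSpace R] :
    (IsTopNilpotentAlgebra R ↔
      ∀ X : LeftBanachModule R, LeftBanachModule.IsSmall X.mulHom) ∧
    (IsTopNilpotentAlgebra R ↔
      ∀ P : LeftBanachModule R, P.IsStrictlyProjective →
        LeftBanachModule.IsSmall P.mulHom) :=
  ⟨⟨fun h X => LeftBanachModule.isSmall_mulHom h X,
    fun h => LeftBanachModule.isTopNilpotentAlgebra_of_isSmall fun P _ => h P⟩,
  ⟨fun h P _ => LeftBanachModule.isSmall_mulHom h P,
    LeftBanachModule.isTopNilpotentAlgebra_of_isSmall⟩⟩
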